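/- Let $K \subseteq \mathbb{R}^n$ be a convex body (a compact convex set with non-empty interior), let $B^n$ be the closed Euclidean unit ball, let $c, d \in \mathbb{R}^n$, and let $R \ge r > 0$ be reals such that $r B^n + c \subseteq K \subseteq R B^n + d$. For convex bodies $K, L \subseteq \mathbb{R}^n$ let \[ d_{BM}(K,L) = \inf\{\rho \ge 0 : K + u \subseteq T(L+v) \subseteq \rho (K+u) \text{ for some invertible linear } T \text{ on } \mathbb{R}^n \text{ and some } u, v \in \mathbb{R}^n\} \] be their Banach--Mazur distance. Then the following conditions are equivalent: (i) $d_{BM}(K, B^n) = \frac{R}{r}$. (ii) For every real symmetric $n \times n$ matrix $A$ and all vectors $v, w \in \mathbb{R}^n$, there exist an inner contact point $y \in \operatorname{bd}(K) \cap \operatorname{bd}(r B^n + c)$ and an outer contact point $z \in \operatorname{bd}(K) \cap \operatorname{bd}(R B^n + d)$ such that \[ \left\langle \frac{y-c}{r}, A\left(\frac{y-c}{r}\right) + v \right\rangle \le \left\langle \frac{z-d}{R}, A\left(\frac{z-d}{R}\right) + w \right\rangle . \] (iii) There exist integers $N, M \ge 1$, inner contact points $y^1, \dots, y^N \in \operatorname{bd}(K)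 \cap \operatorname{bd}(r B^n + c)$, outer contact points $z^1, \dots, z^M \in \operatorname{bd}(K) \cap \operatorname{bd}(R B^n + d)$, and weights $\lambda_1, \dots, \lambda_N, \mu_1, \dots, \mu_M > 0$ such that for every $x \in \mathbb{R}^n$ \[ \sum_{i=1}^N \lambda_i \langle x, y^i - c\rangle (y^i - c) = \sum_{j=1}^M \mu_j \langle x, z^j - d\rangle (z^j - d) \quad\text{and}\quad \sum_{i=1}^N \lambda_i (y^i - c) = \sum_{j=1}^M \mu_j (z^j - d) = 0 . \] Moreover, every decomposition as in (iii) satisfies $r^2 \sum_{i=1}^N \lambda_i = R^2 \sum_{j=1}^M \mu_j$, and if the equivalent conditions hold, then there is a decomposition as in (iii) with $N + M \le \frac{n(n+5)}{2} + 1$. -/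

import Mathlib

open scoped Pointwise

namespace BanachMazur

/-- A convex body in `ℝⁿ`: a compact convex set with non-empty interior. -/
structure IsConvexBody {n : ℕ} (K : Set (EuclideanSpace ℝ (Fin n))) : Prop where
  convex : Convex ℝ K
  isCompact : IsCompact K
  interior_nonempty : (interior K).Nonempty

/-- The Banach–Mazur distance of two convex bodies: the infimum of all `ρ ≥ 0` such that
`K + u ⊆ T (L + v) ⊆ ρ (K + u)` for some invertible linear operator `T` and vectors `u`, `v`. -/
noncomputable def dist {n : ℕ} (K L : Set (EuclideanSpace ℝ (Fin n))) : ℝ :=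
  sInf {ρ : ℝ | 0 ≤ ρ ∧
    ∃ (T : EuclideanSpace ℝ (Fin n) ≃ₗ[ℝ] EuclideanSpace ℝ (Fin n))
      (u v : EuclideanSpace ℝ (Fin n)),
      K + {u} ⊆ T '' (L + {v}) ∧ T '' (L + {v}) ⊆ ρ • (K + {u})}

/-- The closed Euclidean unit ball of `ℝⁿ`. -/
def unitBall (n : ℕ) : Set (EuclideanSpace ℝ (Fin n)) := Metric.closedBall 0 1

/-- The contact points of `K` with the ball `ρ Bⁿ + p`, i.e. the common boundary points. -/
def contactPoints {n : ℕ} (K : Set (EuclideanSpace ℝ (Fin n))) (ρ : ℝ)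
    (p : EuclideanSpace ℝ (Fin n)) : Set (EuclideanSpace ℝ (Fin n)) :=
  frontier K ∩ frontier (ρ • unitBall n + {p})

/-- An Ader decomposition for the chain `r Bⁿ + c ⊆ K ⊆ R Bⁿ + d`: inner contact points `y i`,
outer contact points `z j` and positive weights `lam i`, `mu j` such that the weighted sums of the
rank-one operators `x ↦ ⟨x, y i - c⟩ (y i - c)` and `x ↦ ⟨x, z j - d⟩ (z j - d)` coincide, and the
weighted sums of the shifted points `y i - c` and of the shifted points `z j - d` both vanish. -/
structure IsAderDecomposition {n : ℕ} (K : Set (EuclideanSpace ℝ (Fin n)))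
    (r R : ℝ) (c d : EuclideanSpace ℝ (Fin n)) {N M : ℕ}
    (y : Fin N → EuclideanSpace ℝ (Fin n)) (z : Fin M → EuclideanSpace ℝ (Fin n))
    (lam : Fin N → ℝ) (mu : Fin M → ℝ) : Prop where
  one_le_inner : 1 ≤ N
  one_le_outer : 1 ≤ M
  inner_contact : ∀ i, y i ∈ contactPoints K r c
  outer_contact : ∀ j, z j ∈ contactPoints K R d
  inner_weight_pos : ∀ i, 0 < lam i
  outer_weight_pos : ∀ j, 0 < mu j
  decomposition : ∀ x : EuclideanSpace ℝ (Fin n),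
    ∑ i, (lam i * inner ℝ x (y i - c)) • (y i - c) =
      ∑ j, (mu j * inner ℝ x (z j - d)) • (z j - d)
  inner_balanced : ∑ i, lam i • (y i - c) = 0
  outer_balanced : ∑ j, mu j • (z j - d) = 0

end BanachMazur

/-!
The given chain of balls always shows `dist K Bⁿ ≤ R / r` (`dist_le_div`), so the question is when
it is optimal.

A decomposition forces optimality (`IsAderDecomposition.div_le`). Suppose
`K + u ⊆ T (Bⁿ + v) ⊆ ρ (K + u)`, and write `Y = y - c`, `Z = z - d`. The outer contact points lie in
the ellipsoid, and the half-spaces tangent to the inner ball at the inner contact points contain `K`.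
Summing these conditions with the weights cancels all translations and leaves
`∑ μ ‖T⁻¹ Z‖² ≤ ∑ μ` and `∑ λ / ‖T⁻¹ Y‖ ≤ ρ ∑ λ`. The equality of the weighted rank-one operators
turns the first sum into `∑ λ ‖T⁻¹ Y‖²` and gives `r² ∑ λ = R² ∑ μ`, and convexity of `s ↦ s ^ (-1/2)`
then yields `R / r ≤ ρ`.

Conversely, attach to every contact point a vector in (symmetric matrices) × `ℝⁿ` × `ℝⁿ`, namely
`(Y Yᵀ, Y, 0)` or `(-Z Zᵀ, 0, Z)`. A decomposition exists exactly when the origin is in the convex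
hull of these vectors, and Carathéodory's theorem in dimension `n (n + 5) / 2` bounds the number of
points (`exists_isAderDecomposition_of_zero_mem`). Otherwise the origin can be strictly separated
from the compact hull (`exists_separation_of_zero_notMem`), and the separating functional is a triple
`A`, `v`, `w` with `⟨Y, A Y + v⟩ > 0 > ⟨Z, A Z + w⟩` at all contact points. This violates the
criterion on symmetric matrices. It also improves the chain: the ellipsoids
`‖Y + t (A Y + v)‖ ≤ r` and `‖Z + t (A Z + w)‖ ≤ R` are homothetic, and for small `t > 0` the
first is contained in `K` and the second contains `K` with room to spare, so
`dist K Bⁿ < R / r` (`dist_lt_of_separation`).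
Finally, averaging over a decomposition gives the criterion on symmetric matrices
(`IsAderDecomposition.exists_le`).
-/

namespace BanachMazur

variable {n : ℕ} {K : Set (EuclideanSpace ℝ (Fin n))}

/-! ### Balls, contact points and supporting half-spaces -/

theorem smul_unitBall_add_singleton {ρ : ℝ} (hρ : 0 ≤ ρ) (p : EuclideanSpace ℝ (Fin n)) :
    ρ • unitBall n + {p} = Metric.closedBall p ρ := by
  rw [unitBall, smul_unitClosedBall_of_nonneg hρ, closedBall_add_singleton, zero_add]

theorem contactPoints_eq {ρ : ℝ} (hρ : 0 < ρ) (p : EuclideanSpace ℝ (Fin n)) :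
    contactPoints K ρ p = frontier K ∩ Metric.sphere p ρ := by
  rw [contactPoints, smul_unitBall_add_singleton hρ.le, frontier_closedBall p hρ.ne']

theorem norm_sub_of_mem_contactPoints {ρ : ℝ} (hρ : 0 < ρ) {p y : EuclideanSpace ℝ (Fin n)}
    (hy : y ∈ contactPoints K ρ p) : ‖y - p‖ = ρ := by
  rw [contactPoints_eq hρ] at hy
  exact mem_sphere_iff_norm.1 hy.2

theorem isCompact_contactPoints {ρ : ℝ} (hρ : 0 < ρ)
    (p : EuclideanSpace ℝ (Fin n)) : IsCompact (contactPoints K ρ p) := by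
  rw [contactPoints_eq hρ]
  exact (isCompact_sphere p ρ).inter_left isClosed_frontier

theorem mem_contactPoints_of_subset_closedBall {R : ℝ} (hR : 0 < R)
    {d x : EuclideanSpace ℝ (Fin n)} (h : K ⊆ Metric.closedBall d R) (hx : x ∈ K)
    (hxd : ‖x - d‖ = R) : x ∈ contactPoints K R d := by
  rw [contactPoints_eq hR]
  refine ⟨⟨subset_closure hx, fun hi => ?_⟩, mem_sphere_iff_norm.2 hxd⟩
  have := interior_mono h hi
  rw [interior_closedBall d hR.ne', mem_ball_iff_norm] at this
  exact this.ne hxd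

/-- At an inner contact point the tangent hyperplane of the inscribed ball is the only hyperplane
supporting the body, so the body lies in the corresponding half-space. -/
theorem inner_sub_le_of_mem_contactPoints (hK : Convex ℝ K) {r : ℝ} (hr : 0 < r)
    {c y : EuclideanSpace ℝ (Fin n)} (hball : Metric.closedBall c r ⊆ K)
    (hy : y ∈ contactPoints K r c) {x : EuclideanSpace ℝ (Fin n)} (hx : x ∈ K) :
    inner ℝ (x - c) (y - c) ≤ r ^ 2 := by
  have hY := norm_sub_of_mem_contactPoints hr hy
  have hc : c ∈ interior K := interior_mono hball (by
    rw [interior_closedBall c hr.ne']; exact Metric.mem_ball_self hr)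
  obtain ⟨f, hf0, hf⟩ := geometric_hahn_banach_of_nonempty_interior_point hK hy.1.2 ⟨c, hc⟩
  obtain ⟨w, rfl⟩ := (InnerProductSpace.toDual ℝ (EuclideanSpace ℝ (Fin n))).surjective f
  simp only [InnerProductSpace.toDual_apply_apply] at hf
  have hw : 0 < ‖w‖ := by
    rw [norm_pos_iff]; rintro rfl; simp at hf0
  have h1 := hf (c + (r / ‖w‖) • w) (hball (by
    rw [mem_closedBall_iff_norm, add_sub_cancel_left, norm_smul, Real.norm_of_nonneg (by positivity),
      div_mul_cancel₀ _ hw.ne']))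
  rw [inner_add_right, inner_smul_right, real_inner_self_eq_norm_sq] at h1
  have h2 : r / ‖w‖ * ‖w‖ ^ 2 = r * ‖w‖ := by field_simp
  have h3 : inner ℝ w (y - c) = ‖w‖ * ‖y - c‖ := by
    refine le_antisymm (real_inner_le_norm _ _) ?_
    rw [inner_sub_right, hY]; linarith
  rw [inner_eq_norm_mul_iff_real, hY] at h3
  have h4 : ‖w‖ * inner ℝ (x - c) (y - c) ≤ ‖w‖ * r ^ 2 := by
    calc ‖w‖ * inner ℝ (x - c) (y - c) = r * inner ℝ w (x - c) := by
          rw [← inner_smul_right, ← h3, inner_smul_right, real_inner_comm]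
      _ ≤ r * inner ℝ w (y - c) := by
          have := hf x hx
          rw [inner_sub_right, inner_sub_right]
          gcongr
      _ = ‖w‖ * r ^ 2 := by
          rw [← real_inner_smul_left, h3, real_inner_smul_left, real_inner_self_eq_norm_sq, hY]
  exact le_of_mul_le_mul_left h4 hw

/-! ### Upper bounds for the Banach–Mazur distance to the ball -/

/-- If `K` lies between homothetic ellipsoids `{‖G x - b‖ ≤ r}` and `{‖G x - a‖ ≤ R}`, then every
`ρ ≥ R / r` other than `1` belongs to the set defining the distance. Dilations in that set are
centred at the origin, and for `ρ = 1` no choice of `u` moves `a` relative to `b`. -/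
theorem mem_dist_set {a b : EuclideanSpace ℝ (Fin n)} {r R ρ : ℝ} (hr : 0 < r) (hR : 0 < R)
    (G : EuclideanSpace ℝ (Fin n) ≃ₗ[ℝ] EuclideanSpace ℝ (Fin n))
    (hout : ∀ x ∈ K, ‖G x - a‖ ≤ R) (hin : ∀ x, ‖G x - b‖ ≤ r → x ∈ K)
    (hρ : R / r ≤ ρ) (hρ1 : ρ ≠ 1) :
    0 ≤ ρ ∧ ∃ (T : EuclideanSpace ℝ (Fin n) ≃ₗ[ℝ] EuclideanSpace ℝ (Fin n))
      (u v : EuclideanSpace ℝ (Fin n)),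
      K + {u} ⊆ T '' (unitBall n + {v}) ∧ T '' (unitBall n + {v}) ⊆ ρ • (K + {u}) := by
  have hρ0 : 0 < ρ := (div_pos hR hr).trans_le hρ
  have h1ρ : 1 - ρ ≠ 0 := sub_ne_zero.2 hρ1.symm
  -- the translation making the two homothetic ellipsoids match under scaling by `ρ` about `0`
  set g : EuclideanSpace ℝ (Fin n) := (1 - ρ)⁻¹ • (ρ • b - a) with hg
  refine ⟨hρ0.le, G.symm.trans (LinearEquiv.smulOfNeZero ℝ _ R hR.ne'), G.symm g,
    R⁻¹ • (a + g), ?_, ?_⟩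
  · rintro _ ⟨x, hx, _, rfl, rfl⟩
    refine ⟨R⁻¹ • (G x + g), ⟨R⁻¹ • (G x - a), ?_, _, rfl, ?_⟩, ?_⟩
    · rw [unitBall, mem_closedBall_zero_iff, norm_smul, norm_inv, Real.norm_of_nonneg hR.le,
        inv_mul_le_iff₀ hR, mul_one]
      exact hout x hx
    · simp only [← smul_add]
      congr 1
      abel
    · simp [LinearEquiv.smulOfNeZero_apply, smul_smul, hR.ne']
  · rintro _ ⟨_, ⟨s, hs, _, rfl, rfl⟩, rfl⟩
    rw [unitBall, mem_closedBall_zero_iff] at hs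
    refine ⟨_, ⟨G.symm (b + (R / ρ) • s), hin _ ?_, _, rfl, rfl⟩, ?_⟩
    · rw [G.apply_symm_apply, add_sub_cancel_left, norm_smul, Real.norm_of_nonneg (by positivity)]
      have : R / ρ ≤ r := by
        rw [div_le_iff₀ hρ0, mul_comm]; rwa [div_le_iff₀ hr] at hρ
      nlinarith [norm_nonneg s, div_pos hR hρ0]
    · have key : ρ • (b + g) = a + g := by
        have : (1 - ρ) • g = ρ • b - a := by rw [hg, smul_inv_smul₀ h1ρ]
        rw [sub_smul, one_smul] at this
        have h2 := eq_sub_of_add_eq' (eq_add_of_sub_eq this).symm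
        rw [smul_add, h2]; abel
      simp only [LinearEquiv.trans_apply, LinearEquiv.smulOfNeZero_apply, ← map_smul, ← map_add]
      congr 1
      rw [add_right_comm, smul_add, key, smul_add, smul_smul, smul_smul, mul_inv_cancel₀ hR.ne',
        mul_div_cancel₀ _ hρ0.ne', one_smul, add_comm]

theorem dist_le_div {a b : EuclideanSpace ℝ (Fin n)} {r R : ℝ} (hr : 0 < r) (hR : 0 < R)
    (G : EuclideanSpace ℝ (Fin n) ≃ₗ[ℝ] EuclideanSpace ℝ (Fin n))
    (hout : ∀ x ∈ K, ‖G x - a‖ ≤ R) (hin : ∀ x, ‖G x - b‖ ≤ r → x ∈ K) :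
    dist K (unitBall n) ≤ R / r := by
  refine le_of_forall_gt_imp_ge_of_dense fun ρ hρ => ?_
  by_contra! h
  obtain ⟨σ, hσ1, hσ2⟩ := exists_between h
  -- one of any two distinct factors in the interval differs from `1`, as `mem_dist_set` needs
  obtain ⟨τ, hτ1, hτ2⟩ := exists_between hσ2
  have hb : BddBelow {ρ : ℝ | 0 ≤ ρ ∧
    ∃ (T : EuclideanSpace ℝ (Fin n) ≃ₗ[ℝ] EuclideanSpace ℝ (Fin n))
      (u v : EuclideanSpace ℝ (Fin n)),
      K + {u} ⊆ T '' (unitBall n + {v}) ∧ T '' (unitBall n + {v}) ⊆ ρ • (K + {u})} :=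
    ⟨0, fun _ h => h.1⟩
  have hσR : R / r < σ := lt_trans hρ hσ1
  by_cases h1 : σ = 1
  · have := csInf_le hb (mem_dist_set hr hR G hout hin (hσR.trans hτ1).le (by linarith))
    exact this.not_gt hτ2
  · have := csInf_le hb (mem_dist_set hr hR G hout hin hσR.le h1)
    exact this.not_gt hσ2

/-! ### Perturbing the ellipsoids -/

/-- First-order improvement on a compact set: if `g ≥ 0` on `C` and the derivative `k 0` is
positive at the zeros of `g`, then `g + t k t` is positive on `C` for small `t > 0`. -/
theorem eventually_forall_pos_add_mul {X : Type*} [TopologicalSpace X] {C : Set X}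
    (hC : IsCompact C) {g : X → ℝ} {k : ℝ × X → ℝ} (hg : Continuous g) (hk : Continuous k)
    (hg0 : ∀ x ∈ C, 0 ≤ g x) (hk0 : ∀ x ∈ C, g x = 0 → 0 < k (0, x)) :
    ∀ᶠ t in nhds (0 : ℝ), 0 < t → ∀ x ∈ C, 0 < g x + t * k (t, x) := by
  have : ∀ᶠ t in nhds (0 : ℝ), ∀ x ∈ C, 0 < t → x ∈ C → 0 < g x + t * k (t, x) := by
    refine hC.eventually_forall_of_forall_eventually fun x hx => ?_
    rcases (hg0 x hx).eq_or_lt with h | h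
    · filter_upwards [hk.continuousAt.eventually (lt_mem_nhds (hk0 x hx h.symm))] with z hz ht hzC
      have := hg0 z.2 hzC
      have := mul_pos ht hz
      linarith
    · have hcont : Continuous fun z : ℝ × X => g z.2 + z.1 * k z := by fun_prop
      have h0 : 0 < (fun z : ℝ × X => g z.2 + z.1 * k z) (0, x) := by simpa using h
      filter_upwards [hcont.continuousAt.eventually (lt_mem_nhds h0)] with z hz _ _
      exact hz
  filter_upwards [this] with t ht h0 x hx
  exact ht x hx h0 hx

theorem norm_add_smul_sq (Z q : EuclideanSpace ℝ (Fin n)) (t : ℝ) :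
    ‖Z + t • q‖ ^ 2 = ‖Z‖ ^ 2 + t * (2 * inner ℝ Z q + t * ‖q‖ ^ 2) := by
  rw [norm_add_sq_real, inner_smul_right, norm_smul, mul_pow, Real.norm_eq_abs, sq_abs]
  ring

theorem injective_id_add_smul (A : EuclideanSpace ℝ (Fin n) →L[ℝ] EuclideanSpace ℝ (Fin n)) {t : ℝ}
    (ht : 0 ≤ t) (h : t * ‖A‖ < 1) :
    Function.Injective
      (LinearMap.id + t • A.toLinearMap :
        EuclideanSpace ℝ (Fin n) →ₗ[ℝ] EuclideanSpace ℝ (Fin n)) := by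
  rw [injective_iff_map_eq_zero]
  intro x hx
  have hx' : x = -(t • A x) := eq_neg_of_add_eq_zero_left (by simpa using hx)
  by_contra hne
  have h1 : ‖x‖ ≤ t * (‖A‖ * ‖x‖) := by
    calc ‖x‖ = t * ‖A x‖ := by
          conv_lhs => rw [hx', norm_neg, norm_smul, Real.norm_of_nonneg ht]
      _ ≤ _ := by gcongr; exact A.le_opNorm x
  nlinarith [norm_pos_iff.2 hne]

/-- If the affine fields `A Z + w` and `A Y + v` point inwards at all outer contact points and
outwards at all inner contact points, pulling both balls back along them yields a chain of homothetic
ellipsoids with a smaller ratio. -/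
theorem dist_lt_of_separation (hK : IsConvexBody K) {c d : EuclideanSpace ℝ (Fin n)} {r R : ℝ}
    (hr : 0 < r) (hR : 0 < R) (hin : Metric.closedBall c r ⊆ K) (hout : K ⊆ Metric.closedBall d R)
    (A : EuclideanSpace ℝ (Fin n) →L[ℝ] EuclideanSpace ℝ (Fin n)) (v w : EuclideanSpace ℝ (Fin n))
    (hy : ∀ y ∈ contactPoints K r c, 0 < inner ℝ (y - c) (A (y - c) + v))
    (hz : ∀ z ∈ contactPoints K R d, inner ℝ (z - d) (A (z - d) + w) < 0) :
    dist K (unitBall n) < R / r := by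
  have hc : c ∈ interior K := interior_mono hin (by
    rw [interior_closedBall c hr.ne']; exact Metric.mem_ball_self hr)
  have hfr : IsCompact (frontier K) :=
    hK.isCompact.of_isClosed_subset isClosed_frontier hK.isCompact.isClosed.frontier_subset
  have e1 := eventually_forall_pos_add_mul hK.isCompact (g := fun x => R ^ 2 - ‖x - d‖ ^ 2)
    (k := fun z => -(2 * inner ℝ (z.2 - d) (A (z.2 - d) + w) + z.1 * ‖A (z.2 - d) + w‖ ^ 2))
    (by fun_prop) (by fun_prop)
    (fun x hx => by
      have := mem_closedBall_iff_norm.1 (hout hx)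
      have := pow_le_pow_left₀ (norm_nonneg _) this 2
      linarith)
    (fun x hx h0 => by
      have h1 : ‖x - d‖ = R := by
        rw [← abs_of_pos hR, ← abs_of_nonneg (norm_nonneg (x - d)), ← sq_eq_sq_iff_abs_eq_abs]
        linarith
      have := hz x (mem_contactPoints_of_subset_closedBall hR hout hx h1)
      simp only [zero_mul, add_zero]
      linarith)
  have e2 := eventually_forall_pos_add_mul hfr (g := fun x => ‖x - c‖ ^ 2 - r ^ 2)
    (k := fun z => 2 * inner ℝ (z.2 - c) (A (z.2 - c) + v) + z.1 * ‖A (z.2 - c) + v‖ ^ 2)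
    (by fun_prop) (by fun_prop)
    (fun x hx => by
      have : r ≤ ‖x - c‖ := by
        by_contra! hlt
        refine hx.2 (interior_mono hin ?_)
        rwa [interior_closedBall c hr.ne', mem_ball_iff_norm]
      have := pow_le_pow_left₀ hr.le this 2
      linarith)
    (fun x hx h0 => by
      have h1 : ‖x - c‖ = r := by
        rw [← abs_of_pos hr, ← abs_of_nonneg (norm_nonneg (x - c)), ← sq_eq_sq_iff_abs_eq_abs]
        linarith
      have := hy x (by rw [contactPoints_eq hr]; exact ⟨hx, mem_sphere_iff_norm.2 h1⟩)
      simp only [zero_mul, add_zero]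
      linarith)
  have e3 : ∀ᶠ t in nhds (0 : ℝ), t * ‖A‖ < 1 :=
    (Continuous.tendsto (by fun_prop : Continuous fun t : ℝ => t * ‖A‖) 0).eventually
      (gt_mem_nhds (by simp))
  have e4 : ∀ᶠ t in nhds (0 : ℝ), ‖t • v‖ < r :=
    (Continuous.tendsto (by fun_prop : Continuous fun t : ℝ => ‖t • v‖) 0).eventually
      (gt_mem_nhds (by simpa using hr))
  obtain ⟨t, ⟨⟨⟨h1, h2⟩, h3⟩, h4⟩, ht⟩ :=
    (((((e1.and e2).and e3).and e4).filter_mono nhdsWithin_le_nhds).and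
      (self_mem_nhdsWithin : Set.Ioi (0 : ℝ) ∈ nhdsWithin 0 (Set.Ioi 0))).exists
  have ht : 0 < t := ht
  replace h1 := h1 ht
  replace h2 := h2 ht
  set G := LinearEquiv.ofInjectiveEndo _ (injective_id_add_smul A ht.le h3)
  have hG : ∀ x, G x = x + t • A x := fun x => rfl
  have hGc : Continuous G := G.toLinearMap.continuous_of_finiteDimensional
  have hGd : ∀ x, G x - (G d - t • w) = (x - d) + t • (A (x - d) + w) := fun x => by
    simp only [hG, map_sub, smul_add, smul_sub]; abel
  have hGv : ∀ x, G x - (G c - t • v) = (x - c) + t • (A (x - c) + v) := fun x => by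
    simp only [hG, map_sub, smul_add, smul_sub]; abel
  -- the inner ellipsoid is connected, meets the interior and avoids the boundary
  have hinner : ∀ x, ‖G x - (G c - t • v)‖ ≤ r → x ∈ K := by
    set E : Set (EuclideanSpace ℝ (Fin n)) := {x | ‖G x - (G c - t • v)‖ ≤ r} with hE
    have hEc : IsPreconnected E := by
      have : E = G ⁻¹' Metric.closedBall (G c - t • v) r := by
        ext x; rw [Set.mem_preimage, mem_closedBall_iff_norm]; rfl
      rw [this]
      exact ((convex_closedBall _ _).linear_preimage G.toLinearMap).isPreconnected
    have hcE : c ∈ E := by simpa [hE] using h4.le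
    have hsub : E ⊆ interior K := by
      refine hEc.subset_of_closure_inter_subset isOpen_interior ⟨c, hcE, hc⟩ ?_
      rintro x ⟨hxc, hxE⟩
      by_contra hxi
      have hxf : x ∈ frontier K := ⟨closure_mono interior_subset hxc, hxi⟩
      have hlt := h2 x hxf
      have hle : ‖G x - (G c - t • v)‖ ^ 2 ≤ r ^ 2 := pow_le_pow_left₀ (norm_nonneg _) hxE 2
      rw [hGv, norm_add_smul_sq] at hle
      linarith
    exact fun x hx => interior_subset (hsub hx)
  have hcK : c ∈ K := interior_subset hc
  obtain ⟨x₀, hx₀, hmax⟩ := hK.isCompact.exists_isMaxOn ⟨c, hcK⟩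
    (f := fun x => ‖G x - (G d - t • w)‖) (by fun_prop)
  have hlt : ‖G x₀ - (G d - t • w)‖ < R := by
    refine lt_of_pow_lt_pow_left₀ 2 hR.le ?_
    have := h1 x₀ hx₀
    rw [hGd, norm_add_smul_sq]
    linarith
  obtain ⟨R₁, hR₁, hR₁'⟩ := exists_between hlt
  have hR₁0 : 0 < R₁ := (norm_nonneg _).trans_lt hR₁
  calc dist K (unitBall n) ≤ R₁ / r :=
        dist_le_div hr hR₁0 G (fun x hx => (hmax hx).trans hR₁.le) hinner
    _ < R / r := by gcongr

/-! ### Convex hulls of compact sets -/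

/-- By Carathéodory's theorem, the convex hull of a compact set is the image of a product of a
simplex with a power of the set. -/
theorem isCompact_convexHull_of_isCompact {V : Type*} [NormedAddCommGroup V] [NormedSpace ℝ V]
    [FiniteDimensional ℝ V] {C : Set V} (hC : IsCompact C) : IsCompact (convexHull ℝ C) := by
  rcases C.eq_empty_or_nonempty with rfl | ⟨p₀, hp₀⟩
  · simp
  set m := Module.finrank ℝ V + 1
  have himage : convexHull ℝ C = (fun q : (Fin m → ℝ) × (Fin m → V) => ∑ i, q.1 i • q.2 i) ''
      (stdSimplex ℝ (Fin m) ×ˢ Set.univ.pi fun _ => C) := by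
    apply Set.Subset.antisymm
    · intro x hx
      obtain ⟨ι, _, p, a, hp, hind, ha, hsum, rfl⟩ := eq_pos_convex_span_of_mem_convexHull hx
      have hcard : Fintype.card ι ≤ m :=
        hind.card_le_finrank_succ.trans (Nat.succ_le_succ (Submodule.finrank_le _))
      obtain ⟨e⟩ : Nonempty (ι ↪ Fin m) := Function.Embedding.nonempty_of_card_le (by simpa)
      have hext : ∀ i, Function.extend e a (fun _ => 0) (e i) = a i := e.injective.extend_apply a _
      have hpext : ∀ i, Function.extend e p (fun _ => p₀) (e i) = p i :=
        e.injective.extend_apply p _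
      have hout : ∀ j ∉ Set.range e, Function.extend e a (fun _ => 0) j = 0 := fun j hj =>
        Function.extend_apply' a _ j hj
      -- pad with zero weights up to the number of points that suffices in dimension `m - 1`
      refine ⟨(Function.extend e a fun _ => 0, Function.extend e p fun _ => p₀),
        ⟨⟨fun j => ?_, ?_⟩, ?_⟩, ?_⟩
      · by_cases hj : j ∈ Set.range e
        · obtain ⟨i, rfl⟩ := hj
          exact (ha i).le.trans_eq (hext i).symm
        · exact (hout j hj).ge
      · rw [← hsum]
        exact (Fintype.sum_of_injective e e.injective _ _ hout fun i => (hext i).symm).symm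
      · intro j _
        by_cases hj : j ∈ Set.range e
        · obtain ⟨i, rfl⟩ := hj
          exact Set.mem_of_eq_of_mem (hpext i) (hp ⟨i, rfl⟩)
        · exact Set.mem_of_eq_of_mem (Function.extend_apply' p (fun _ => p₀) j hj) hp₀
      · refine (Fintype.sum_of_injective e e.injective _ _ (fun j hj => ?_) fun i => ?_).symm
        · simp only [hout j hj, zero_smul]
        · simp only [hext, hpext]
    · rintro _ ⟨⟨a, p⟩, ⟨ha, hp⟩, rfl⟩
      exact (convex_convexHull ℝ C).sum_mem (fun i _ => ha.1 i) ha.2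
        fun i _ => subset_convexHull ℝ C (hp i trivial)
  rw [himage]
  exact ((isCompact_stdSimplex ℝ (Fin m)).prod (isCompact_univ_pi fun _ => hC)).image
    (by fun_prop)

/-- A compact set whose convex hull misses the origin lies in an open half-space `{f > 0}`. -/
theorem exists_pos_of_zero_notMem_convexHull {V : Type*} [NormedAddCommGroup V] [NormedSpace ℝ V]
    [FiniteDimensional ℝ V] {C : Set V} (hC : IsCompact C) (h : (0 : V) ∉ convexHull ℝ C) :
    ∃ f : V →L[ℝ] ℝ, ∀ p ∈ C, 0 < f p := by
  obtain ⟨f, u, hu, hf⟩ := geometric_hahn_banach_point_closed (convex_convexHull ℝ C)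
    (isCompact_convexHull_of_isCompact hC).isClosed h
  rw [map_zero] at hu
  exact ⟨f, fun p hp => hu.trans (hf p (subset_convexHull ℝ C hp))⟩

/-! ### Equality of weighted sums of rank-one operators -/

section RankOne

variable {ι κ : Type*} [Fintype ι] [Fintype κ] {Y : ι → EuclideanSpace ℝ (Fin n)}
  {Z : κ → EuclideanSpace ℝ (Fin n)} {lam : ι → ℝ} {mu : κ → ℝ}

/-- Two equal weighted sums of rank-one operators have the same trace against every operator. -/
theorem sum_mul_inner_apply_eq
    (h : ∀ x, ∑ i, (lam i * inner ℝ x (Y i)) • Y i = ∑ j, (mu j * inner ℝ x (Z j)) • Z j)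
    (B : EuclideanSpace ℝ (Fin n) →ₗ[ℝ] EuclideanSpace ℝ (Fin n)) :
    ∑ i, lam i * inner ℝ (Y i) (B (Y i)) = ∑ j, mu j * inner ℝ (Z j) (B (Z j)) := by
  have hb : ∀ y : EuclideanSpace ℝ (Fin n), inner ℝ y (B y) =
      ∑ k, inner ℝ (EuclideanSpace.basisFun (Fin n) ℝ k) y *
        inner ℝ (B.adjoint (EuclideanSpace.basisFun (Fin n) ℝ k)) y := fun y => by
    rw [← (EuclideanSpace.basisFun (Fin n) ℝ).sum_inner_mul_inner]
    refine Finset.sum_congr rfl fun k _ => ?_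
    rw [LinearMap.adjoint_inner_left, real_inner_comm y]
  have key : ∀ x w, ∑ i, lam i * (inner ℝ x (Y i) * inner ℝ w (Y i)) =
      ∑ j, mu j * (inner ℝ x (Z j) * inner ℝ w (Z j)) := fun x w => by
    simpa only [inner_sum, inner_smul_right, mul_assoc] using congrArg (fun u => inner ℝ w u) (h x)
  simp only [hb, Finset.mul_sum]
  rw [Finset.sum_comm, Finset.sum_comm (s := Finset.univ (α := κ))]
  exact Finset.sum_congr rfl fun k _ => key _ _

theorem sum_mul_norm_apply_sq_eq
    (h : ∀ x, ∑ i, (lam i * inner ℝ x (Y i)) • Y i = ∑ j, (mu j * inner ℝ x (Z j)) • Z j)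
    (L : EuclideanSpace ℝ (Fin n) →ₗ[ℝ] EuclideanSpace ℝ (Fin n)) :
    ∑ i, lam i * ‖L (Y i)‖ ^ 2 = ∑ j, mu j * ‖L (Z j)‖ ^ 2 := by
  simpa [LinearMap.adjoint_inner_right] using sum_mul_inner_apply_eq h (L.adjoint ∘ₗ L)

theorem sq_mul_sum_eq {r R : ℝ}
    (h : ∀ x, ∑ i, (lam i * inner ℝ x (Y i)) • Y i = ∑ j, (mu j * inner ℝ x (Z j)) • Z j)
    (hY : ∀ i, ‖Y i‖ = r) (hZ : ∀ j, ‖Z j‖ = R) :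
    r ^ 2 * ∑ i, lam i = R ^ 2 * ∑ j, mu j := by
  have := sum_mul_norm_apply_sq_eq h LinearMap.id
  simp only [LinearMap.id_apply, hY, hZ, ← Finset.sum_mul] at this
  linarith

end RankOne

theorem IsAderDecomposition.sq_mul_sum_eq {r R : ℝ} {c d : EuclideanSpace ℝ (Fin n)} {N M : ℕ}
    {y : Fin N → EuclideanSpace ℝ (Fin n)} {z : Fin M → EuclideanSpace ℝ (Fin n)}
    {lam : Fin N → ℝ} {mu : Fin M → ℝ} (h : IsAderDecomposition K r R c d y z lam mu)
    (hr : 0 < r) (hR : 0 < R) : r ^ 2 * ∑ i, lam i = R ^ 2 * ∑ j, mu j :=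
  BanachMazur.sq_mul_sum_eq h.decomposition
    (fun i => norm_sub_of_mem_contactPoints hr (h.inner_contact i))
    (fun j => norm_sub_of_mem_contactPoints hR (h.outer_contact j))

/-- Averaging over a decomposition rules out a strict inequality between all inner and all outer
contact points. -/
theorem IsAderDecomposition.exists_le {r R : ℝ} {c d : EuclideanSpace ℝ (Fin n)} {N M : ℕ}
    {y : Fin N → EuclideanSpace ℝ (Fin n)} {z : Fin M → EuclideanSpace ℝ (Fin n)}
    {lam : Fin N → ℝ} {mu : Fin M → ℝ} (h : IsAderDecomposition K r R c d y z lam mu)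
    (hr : 0 < r) (hR : 0 < R) (A : EuclideanSpace ℝ (Fin n) →ₗ[ℝ] EuclideanSpace ℝ (Fin n))
    (v w : EuclideanSpace ℝ (Fin n)) :
    ∃ y ∈ contactPoints K r c, ∃ z ∈ contactPoints K R d,
      inner ℝ (r⁻¹ • (y - c)) (A (r⁻¹ • (y - c)) + v) ≤
        inner ℝ (R⁻¹ • (z - d)) (A (R⁻¹ • (z - d)) + w) := by
  by_contra! hlt
  have hexp : ∀ (s : ℝ) (x q : EuclideanSpace ℝ (Fin n)), inner ℝ (s • x) (A (s • x) + q) =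
      s ^ 2 * inner ℝ x (A x) + s * inner ℝ q x := fun s x q => by
    rw [map_smul, inner_add_right, real_inner_smul_left, real_inner_smul_left, inner_smul_right,
      real_inner_comm q]
    ring
  have hin : ∑ i, lam i * inner ℝ (r⁻¹ • (y i - c)) (A (r⁻¹ • (y i - c)) + v) =
      r⁻¹ ^ 2 * ∑ i, lam i * inner ℝ (y i - c) (A (y i - c)) := by
    have h0 : ∑ i, lam i * inner ℝ v (y i - c) = 0 := by
      simpa [inner_sum, inner_smul_right] using congrArg (fun u => inner ℝ v u) h.inner_balanced
    calc _ = r⁻¹ ^ 2 * ∑ i, lam i * inner ℝ (y i - c) (A (y i - c)) +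
          r⁻¹ * ∑ i, lam i * inner ℝ v (y i - c) := by
          simp only [hexp, Finset.mul_sum, ← Finset.sum_add_distrib]
          exact Finset.sum_congr rfl fun i _ => by ring
      _ = _ := by rw [h0, mul_zero, add_zero]
  have hout : ∑ j, mu j * inner ℝ (R⁻¹ • (z j - d)) (A (R⁻¹ • (z j - d)) + w) =
      R⁻¹ ^ 2 * ∑ j, mu j * inner ℝ (z j - d) (A (z j - d)) := by
    have h0 : ∑ j, mu j * inner ℝ w (z j - d) = 0 := by
      simpa [inner_sum, inner_smul_right] using congrArg (fun u => inner ℝ w u) h.outer_balanced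
    calc _ = R⁻¹ ^ 2 * ∑ j, mu j * inner ℝ (z j - d) (A (z j - d)) +
          R⁻¹ * ∑ j, mu j * inner ℝ w (z j - d) := by
          simp only [hexp, Finset.mul_sum, ← Finset.sum_add_distrib]
          exact Finset.sum_congr rfl fun i _ => by ring
      _ = _ := by rw [h0, mul_zero, add_zero]
  have hS := sum_mul_inner_apply_eq h.decomposition A
  have htr := h.sq_mul_sum_eq hr hR
  set f := fun i => inner ℝ (r⁻¹ • (y i - c)) (A (r⁻¹ • (y i - c)) + v)
  set g := fun j => inner ℝ (R⁻¹ • (z j - d)) (A (R⁻¹ • (z j - d)) + w)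
  have hpos : 0 < ∑ i, ∑ j, lam i * mu j * (f i - g j) :=
    Finset.sum_pos (fun i _ => Finset.sum_pos (fun j _ =>
      mul_pos (mul_pos (h.inner_weight_pos i) (h.outer_weight_pos j))
        (sub_pos.2 (hlt _ (h.inner_contact i) _ (h.outer_contact j))))
      ⟨⟨0, h.one_le_outer⟩, Finset.mem_univ _⟩) ⟨⟨0, h.one_le_inner⟩, Finset.mem_univ _⟩
  have hsplit : ∑ i, ∑ j, lam i * mu j * (f i - g j) =
      (∑ i, lam i * f i) * ∑ j, mu j - (∑ i, lam i) * ∑ j, mu j * g j := by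
    simp only [Finset.sum_mul_sum, ← Finset.sum_sub_distrib]
    exact Finset.sum_congr rfl fun i _ => Finset.sum_congr rfl fun j _ => by ring
  rw [hsplit, hin, hout, ← hS] at hpos
  have : (r⁻¹ ^ 2 * ∑ i, lam i * inner ℝ (y i - c) (A (y i - c))) * ∑ j, mu j -
      (∑ i, lam i) * (R⁻¹ ^ 2 * ∑ i, lam i * inner ℝ (y i - c) (A (y i - c))) =
      r⁻¹ ^ 2 * R⁻¹ ^ 2 * (∑ i, lam i * inner ℝ (y i - c) (A (y i - c))) *
        (R ^ 2 * ∑ j, mu j - r ^ 2 * ∑ i, lam i) := by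
    field_simp
  rw [this, htr, sub_self, mul_zero] at hpos
  exact hpos.false

/-! ### The lower bound for the distance -/

/-- The tangent line of `s ↦ 1 / s` as a function of `s ^ 2`, at `s = 1 / k`. -/
theorem tangent_le_inv {k s : ℝ} (hk : 0 < k) (hs : 0 < s) :
    k / 2 * (3 - k ^ 2 * s ^ 2) ≤ s⁻¹ := by
  rw [← one_div, le_div_iff₀ hs]
  nlinarith [mul_nonneg (sq_nonneg (k * s - 1)) (by positivity : 0 ≤ k * s + 2)]

/-- Any ellipsoid squeezed between translates of `K` and `ρ • K` satisfies `R / r ≤ ρ`: an outer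
contact point bounds `‖T⁻¹ (z - d)‖`, and the supporting half-space at an inner contact point bounds
`‖T⁻¹ (y - c)‖⁻¹`. The decomposition removes the translations and identifies the two averages of
squares, which convexity of `s ↦ s ^ (-1/2)` compares. -/
theorem IsAderDecomposition.div_le {r R : ℝ} {c d : EuclideanSpace ℝ (Fin n)} {N M : ℕ}
    {y : Fin N → EuclideanSpace ℝ (Fin n)} {z : Fin M → EuclideanSpace ℝ (Fin n)}
    {lam : Fin N → ℝ} {mu : Fin M → ℝ} (h : IsAderDecomposition K r R c d y z lam mu)
    (hK : IsConvexBody K) (hr : 0 < r) (hR : 0 < R) (hball : Metric.closedBall c r ⊆ K) {ρ : ℝ}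
    (hρ : 0 ≤ ρ)
    (T : EuclideanSpace ℝ (Fin n) ≃ₗ[ℝ] EuclideanSpace ℝ (Fin n))
    (u v : EuclideanSpace ℝ (Fin n)) (h1 : K + {u} ⊆ T '' (unitBall n + {v}))
    (h2 : T '' (unitBall n + {v}) ⊆ ρ • (K + {u})) : R / r ≤ ρ := by
  have hN : (Finset.univ : Finset (Fin N)).Nonempty := ⟨⟨0, h.one_le_inner⟩, Finset.mem_univ _⟩
  have hΛ : 0 < ∑ i, lam i := Finset.sum_pos (fun i _ => h.inner_weight_pos i) hN
  have hfr : frontier K ⊆ K := hK.isCompact.isClosed.frontier_subset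
  have hzT : ∑ j, mu j * ‖T.symm (z j - d)‖ ^ 2 ≤ ∑ j, mu j := by
    set e := T.symm (d + u) - v with he
    have hle : ∀ j, ‖T.symm (z j - d)‖ ^ 2 + 2 * inner ℝ e (T.symm (z j - d)) ≤ 1 := fun j => by
      obtain ⟨_, ⟨s, hs, v', hv', rfl⟩, hTs⟩ :=
        h1 ⟨z j, hfr (h.outer_contact j).1, u, rfl, rfl⟩
      rw [Set.mem_singleton_iff.1 hv'] at hTs
      rw [unitBall, mem_closedBall_zero_iff] at hs
      have hs' : s = T.symm (z j - d) + e := by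
        have : s + v = T.symm (z j + u) := by
          rw [LinearEquiv.eq_symm_apply]; exact hTs
        rw [he, eq_sub_of_add_eq this]
        simp only [map_add, map_sub]
        abel
      have hs2 : ‖s‖ ^ 2 ≤ 1 := pow_le_one₀ (norm_nonneg s) hs
      rw [hs', norm_add_sq_real, real_inner_comm] at hs2
      nlinarith [sq_nonneg ‖e‖]
    have h0 : ∑ j, mu j * inner ℝ e (T.symm (z j - d)) = 0 := by
      have := congrArg (fun q => inner ℝ e (T.symm q)) h.outer_balanced
      simpa [map_sum, inner_sum, inner_smul_right, -map_sub] using this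
    have := Finset.sum_le_sum fun j (_ : j ∈ Finset.univ) =>
      mul_le_mul_of_nonneg_left (hle j) (h.outer_weight_pos j).le
    calc ∑ j, mu j * ‖T.symm (z j - d)‖ ^ 2 =
          ∑ j, mu j * ‖T.symm (z j - d)‖ ^ 2 +
            2 * ∑ j, mu j * inner ℝ e (T.symm (z j - d)) := by rw [h0, mul_zero, add_zero]
      _ = ∑ j, mu j * (‖T.symm (z j - d)‖ ^ 2 + 2 * inner ℝ e (T.symm (z j - d))) := by
          rw [Finset.mul_sum, ← Finset.sum_add_distrib]
          exact Finset.sum_congr rfl fun j _ => by ring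
      _ ≤ _ := by simpa using this
  have hyT : ∑ i, lam i * ‖T.symm (y i - c)‖ ^ 2 = ∑ j, mu j * ‖T.symm (z j - d)‖ ^ 2 :=
    sum_mul_norm_apply_sq_eq h.decomposition T.symm.toLinearMap
  have hnorm : ∀ i, ‖y i - c‖ = r := fun i => norm_sub_of_mem_contactPoints hr (h.inner_contact i)
  have hspos : ∀ i, 0 < ‖T.symm (y i - c)‖ := fun i => by
    rw [norm_pos_iff, ne_eq, LinearEquiv.map_eq_zero_iff, ← norm_eq_zero, hnorm i]
    exact hr.ne'
  have hinv : r ^ 2 * ∑ i, lam i * ‖T.symm (y i - c)‖⁻¹ ≤ ρ * r ^ 2 * ∑ i, lam i := by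
    set e := T v - ρ • (u + c) with he
    have hle : ∀ i, r ^ 2 * ‖T.symm (y i - c)‖⁻¹ + inner ℝ e (y i - c) ≤ ρ * r ^ 2 := fun i => by
      -- the point of the ellipsoid in the direction of the contact point
      have hmem : T (‖T.symm (y i - c)‖⁻¹ • T.symm (y i - c) + v) ∈ T '' (unitBall n + {v}) := by
        refine ⟨_, ⟨_, ?_, v, rfl, rfl⟩, rfl⟩
        rw [unitBall, mem_closedBall_zero_iff, norm_smul, norm_inv, norm_norm,
          inv_mul_cancel₀ (hspos i).ne']
      obtain ⟨_, ⟨x, hx, u', hu', rfl⟩, hxT⟩ := h2 hmem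
      rw [Set.mem_singleton_iff.1 hu'] at hxT
      have hsupp := inner_sub_le_of_mem_contactPoints hK.convex hr hball (h.inner_contact i) hx
      have heq : ‖T.symm (y i - c)‖⁻¹ • (y i - c) + e = ρ • (x - c) := by
        simp only [map_add, map_smul, LinearEquiv.apply_symm_apply] at hxT
        rw [he, ← add_sub_assoc, ← hxT]
        simp only [smul_add, smul_sub]
        abel
      have hin := congrArg (fun q => inner ℝ q (y i - c)) heq
      simp only [inner_add_left, real_inner_smul_left, real_inner_self_eq_norm_sq, hnorm i] at hin
      rw [mul_comm (r ^ 2), hin]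
      exact mul_le_mul_of_nonneg_left hsupp hρ
    have h0 : ∑ i, lam i * inner ℝ e (y i - c) = 0 := by
      simpa [inner_sum, inner_smul_right] using congrArg (fun q => inner ℝ e q) h.inner_balanced
    have := Finset.sum_le_sum fun i (_ : i ∈ Finset.univ) =>
      mul_le_mul_of_nonneg_left (hle i) (h.inner_weight_pos i).le
    calc r ^ 2 * ∑ i, lam i * ‖T.symm (y i - c)‖⁻¹ =
          r ^ 2 * ∑ i, lam i * ‖T.symm (y i - c)‖⁻¹ + ∑ i, lam i * inner ℝ e (y i - c) := by
          rw [h0, add_zero]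
      _ = ∑ i, lam i * (r ^ 2 * ‖T.symm (y i - c)‖⁻¹ + inner ℝ e (y i - c)) := by
          rw [Finset.mul_sum, ← Finset.sum_add_distrib]
          exact Finset.sum_congr rfl fun j _ => by ring
      _ ≤ ∑ i, lam i * (ρ * r ^ 2) := this
      _ = ρ * r ^ 2 * ∑ i, lam i := by rw [← Finset.sum_mul, mul_comm]
  have hk : 0 < R / r := div_pos hR hr
  have htan : R / r / 2 * (3 * ∑ i, lam i - (R / r) ^ 2 * ∑ i, lam i * ‖T.symm (y i - c)‖ ^ 2) ≤
      ∑ i, lam i * ‖T.symm (y i - c)‖⁻¹ := by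
    have := Finset.sum_le_sum fun i (_ : i ∈ Finset.univ) =>
      mul_le_mul_of_nonneg_left (tangent_le_inv hk (hspos i)) (h.inner_weight_pos i).le
    refine le_trans (le_of_eq ?_) this
    simp only [Finset.mul_sum, mul_sub, ← Finset.sum_sub_distrib]
    exact Finset.sum_congr rfl fun i _ => by ring
  have hmu : (R / r) ^ 2 * ∑ i, lam i * ‖T.symm (y i - c)‖ ^ 2 ≤ ∑ i, lam i := by
    rw [hyT]
    calc (R / r) ^ 2 * _ ≤ (R / r) ^ 2 * ∑ j, mu j := by gcongr
      _ = ∑ i, lam i := by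
        rw [div_pow, div_mul_eq_mul_div, ← h.sq_mul_sum_eq hr hR, mul_div_cancel_left₀]
        positivity
  refine le_of_mul_le_mul_right ?_ hΛ
  calc R / r * ∑ i, lam i = R / r / 2 * (3 * ∑ i, lam i - ∑ i, lam i) := by ring
    _ ≤ R / r / 2 * (3 * ∑ i, lam i - (R / r) ^ 2 * ∑ i, lam i * ‖T.symm (y i - c)‖ ^ 2) := by
        gcongr
    _ ≤ ∑ i, lam i * ‖T.symm (y i - c)‖⁻¹ := htan
    _ ≤ ρ * ∑ i, lam i := by
        refine le_of_mul_le_mul_left ?_ (pow_pos hr 2)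
        linarith

/-! ### Decompositions as convex combinations -/

/-- The symmetrized product of two vectors. Symmetric matrices are encoded as functions on
unordered pairs of indices, so that their space has dimension `n * (n + 1) / 2`; the diagonal
`symProd x x` is the rank-one matrix with entries `x i * x j`. -/
noncomputable def symProd : EuclideanSpace ℝ (Fin n) →ₗ[ℝ] EuclideanSpace ℝ (Fin n) →ₗ[ℝ]
    (Sym2 (Fin n) → ℝ) :=
  LinearMap.mk₂ ℝ
    (fun x y => Sym2.lift ⟨fun i j => (x i * y j + x j * y i) / 2, fun i j => by ring⟩)
    (fun x x' y => by
      ext s; induction s with | _ i j => simp; ring)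
    (fun a x y => by
      ext s; induction s with | _ i j => simp; ring)
    (fun x y y' => by
      ext s; induction s with | _ i j => simp; ring)
    (fun a x y => by
      ext s; induction s with | _ i j => simp; ring)

theorem symProd_apply_mk (x y : EuclideanSpace ℝ (Fin n)) (i j : Fin n) :
    symProd x y s(i, j) = (x i * y j + x j * y i) / 2 := rfl

theorem symProd_comm (x y : EuclideanSpace ℝ (Fin n)) : symProd x y = symProd y x := by
  ext s
  induction s with | _ i j => rw [symProd_apply_mk, symProd_apply_mk]; ring

/-- Every linear functional of the rank-one matrices `x xᵀ` is the quadratic form of a symmetric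
matrix. -/
theorem exists_isSymm_apply_symProd_self (f : (Sym2 (Fin n) → ℝ) →ₗ[ℝ] ℝ) :
    ∃ A : Matrix (Fin n) (Fin n) ℝ, A.IsSymm ∧
      ∀ x, f (symProd x x) = inner ℝ x (Matrix.toEuclideanLin A x) := by
  set e := EuclideanSpace.basisFun (Fin n) ℝ
  refine ⟨Matrix.of fun i j => f (symProd (e i) (e j)), ?_, fun x => ?_⟩
  · ext i j
    simp [symProd_comm (e i)]
  · have hx : x = ∑ i, x i • e i := by
      conv_lhs => rw [← e.sum_repr x]
      simp [e]
    calc f (symProd x x) = ∑ i, x i * ∑ j, x j * f (symProd (e i) (e j)) := by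
          conv_lhs => rw [hx]
          simp only [map_sum, map_smul, LinearMap.sum_apply, LinearMap.smul_apply, smul_eq_mul,
            Finset.mul_sum]
          exact Finset.sum_congr rfl fun i _ => Finset.sum_congr rfl fun j _ => by
            rw [symProd_comm]
      _ = _ := by
          simp only [PiLp.inner_apply, Matrix.toLpLin_apply, Matrix.mulVec, dotProduct,
            Matrix.of_apply, RCLike.inner_apply, conj_trivial]
          refine Finset.sum_congr rfl fun i _ => ?_
          rw [mul_comm]
          congr 1
          exact Finset.sum_congr rfl fun j _ => mul_comm _ _

theorem sum_smul_inner_apply {ι : Type*} [Fintype ι] (Y : ι → EuclideanSpace ℝ (Fin n)) (a : ι → ℝ)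
    (x : EuclideanSpace ℝ (Fin n)) (k : Fin n) :
    (∑ i, (a i * inner ℝ x (Y i)) • Y i) k = ∑ l, x l * ∑ i, a i * (Y i l * Y i k) := by
  simp only [WithLp.ofLp_sum, Finset.sum_apply, PiLp.smul_apply, smul_eq_mul, PiLp.inner_apply,
    RCLike.inner_apply, conj_trivial, Finset.mul_sum, Finset.sum_mul]
  rw [Finset.sum_comm]
  exact Finset.sum_congr rfl fun l _ => Finset.sum_congr rfl fun i _ => by ring

theorem sum_smul_inner_eq_of_symProd {ι κ : Type*} [Fintype ι] [Fintype κ]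
    {Y : ι → EuclideanSpace ℝ (Fin n)} {Z : κ → EuclideanSpace ℝ (Fin n)} {lam : ι → ℝ} {mu : κ → ℝ}
    (h : ∑ i, lam i • symProd (Y i) (Y i) = ∑ j, mu j • symProd (Z j) (Z j))
    (x : EuclideanSpace ℝ (Fin n)) :
    ∑ i, (lam i * inner ℝ x (Y i)) • Y i = ∑ j, (mu j * inner ℝ x (Z j)) • Z j := by
  have hentry : ∀ k l, ∑ i, lam i * (Y i l * Y i k) = ∑ j, mu j * (Z j l * Z j k) := fun k l => by
    have := congrFun h s(l, k)
    simp only [Finset.sum_apply, Pi.smul_apply, symProd_apply_mk, smul_eq_mul] at this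
    convert this using 3 <;> ring
  ext k
  rw [sum_smul_inner_apply, sum_smul_inner_apply]
  exact Finset.sum_congr rfl fun l _ => by rw [hentry k l]

theorem exists_isAderDecomposition_of_fintype {r R : ℝ} (hr : 0 < r) (hR : 0 < R)
    {c d : EuclideanSpace ℝ (Fin n)} {ι κ : Type*} [Fintype ι] [Fintype κ]
    {y : ι → EuclideanSpace ℝ (Fin n)} {z : κ → EuclideanSpace ℝ (Fin n)} {lam : ι → ℝ} {mu : κ → ℝ}
    (hy : ∀ i, y i ∈ contactPoints K r c) (hz : ∀ j, z j ∈ contactPoints K R d)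
    (hlam : ∀ i, 0 < lam i) (hmu : ∀ j, 0 < mu j)
    (h : ∑ i, lam i • symProd (y i - c) (y i - c) = ∑ j, mu j • symProd (z j - d) (z j - d))
    (hyb : ∑ i, lam i • (y i - c) = 0) (hzb : ∑ j, mu j • (z j - d) = 0)
    (hpos : 0 < ∑ i, lam i + ∑ j, mu j) :
    ∃ (y' : Fin (Fintype.card ι) → EuclideanSpace ℝ (Fin n))
      (z' : Fin (Fintype.card κ) → EuclideanSpace ℝ (Fin n))
      (lam' : Fin (Fintype.card ι) → ℝ) (mu' : Fin (Fintype.card κ) → ℝ),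
      IsAderDecomposition K r R c d y' z' lam' mu' := by
  have hdec := sum_smul_inner_eq_of_symProd h
  have htr := sq_mul_sum_eq hdec (fun i => norm_sub_of_mem_contactPoints hr (hy i))
    fun j => norm_sub_of_mem_contactPoints hR (hz j)
  let eι := (Fintype.equivFin ι).symm
  let eκ := (Fintype.equivFin κ).symm
  refine ⟨y ∘ eι, z ∘ eκ, lam ∘ eι, mu ∘ eκ, ?_, ?_, fun i => hy _, fun j => hz _, fun i => hlam _,
    fun j => hmu _, fun x => ?_, ?_, ?_⟩
  · rw [Nat.one_le_iff_ne_zero, ne_eq, Fintype.card_eq_zero_iff]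
    intro hι
    simp only [Finset.univ_eq_empty, Finset.sum_empty, mul_zero, zero_add] at htr hpos
    exact (mul_pos (pow_pos hR 2) hpos).ne htr
  · rw [Nat.one_le_iff_ne_zero, ne_eq, Fintype.card_eq_zero_iff]
    intro hκ
    simp only [Finset.univ_eq_empty, Finset.sum_empty, mul_zero, add_zero] at htr hpos
    exact (mul_pos (pow_pos hr 2) hpos).ne' htr
  · simp only [Function.comp_apply]
    rw [eι.sum_comp fun i => (lam i * inner ℝ x (y i - c)) • (y i - c),
      eκ.sum_comp fun j => (mu j * inner ℝ x (z j - d)) • (z j - d)]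
    exact hdec x
  · simpa only [Function.comp_apply, eι.sum_comp fun i => lam i • (y i - c)] using hyb
  · simpa only [Function.comp_apply, eκ.sum_comp fun j => mu j • (z j - d)] using hzb

/-- The vectors whose convex hull contains the origin exactly when a decomposition exists: an inner
contact point `y` contributes `((y - c) (y - c)ᵀ, y - c, 0)` and an outer contact point `z`
contributes `(-(z - d) (z - d)ᵀ, 0, z - d)`. -/
noncomputable def contactVectors (K : Set (EuclideanSpace ℝ (Fin n))) (r R : ℝ)
    (c d : EuclideanSpace ℝ (Fin n)) :
    Set ((Sym2 (Fin n) → ℝ) × EuclideanSpace ℝ (Fin n) × EuclideanSpace ℝ (Fin n)) :=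
  (fun y => (symProd (y - c) (y - c), y - c, 0)) '' contactPoints K r c ∪
    (fun z => (-symProd (z - d) (z - d), 0, z - d)) '' contactPoints K R d

theorem continuous_symProd_sub_self (p : EuclideanSpace ℝ (Fin n)) :
    Continuous fun x => symProd (x - p) (x - p) := by
  refine continuous_pi fun s => ?_
  induction s with | _ i j => simp only [symProd_apply_mk]; fun_prop

theorem isCompact_contactVectors {r R : ℝ} (hr : 0 < r) (hR : 0 < R)
    (c d : EuclideanSpace ℝ (Fin n)) : IsCompact (contactVectors K r R c d) := by
  have hc := continuous_symProd_sub_self c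
  have hd := continuous_symProd_sub_self d
  exact ((isCompact_contactPoints hr c).image (by fun_prop)).union
    ((isCompact_contactPoints hR d).image (by fun_prop))

theorem finrank_sym2_prod :
    Module.finrank ℝ ((Sym2 (Fin n) → ℝ) × EuclideanSpace ℝ (Fin n) × EuclideanSpace ℝ (Fin n)) =
      n * (n + 5) / 2 := by
  simp only [Module.finrank_prod, Module.finrank_pi, finrank_euclideanSpace, Sym2.card,
    Fintype.card_fin, Nat.choose_two_right, Nat.add_sub_cancel]
  rw [show n * (n + 5) = (n + 1) * n + (n + n) * 2 by ring, Nat.add_mul_div_right _ _ two_pos]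

theorem exists_isAderDecomposition_of_zero_mem {r R : ℝ} (hr : 0 < r) (hR : 0 < R)
    {c d : EuclideanSpace ℝ (Fin n)} (h : 0 ∈ convexHull ℝ (contactVectors K r R c d)) :
    ∃ (N M : ℕ) (y : Fin N → EuclideanSpace ℝ (Fin n)) (z : Fin M → EuclideanSpace ℝ (Fin n))
      (lam : Fin N → ℝ) (mu : Fin M → ℝ),
      IsAderDecomposition K r R c d y z lam mu ∧ N + M ≤ n * (n + 5) / 2 + 1 := by
  classical
  obtain ⟨ι, _, p, a, hp, hind, ha, hsum, h0⟩ := eq_pos_convex_span_of_mem_convexHull h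
  let P : ι → Prop := fun i => ∃ y ∈ contactPoints K r c, (symProd (y - c) (y - c), y - c, 0) = p i
  have hQ : ∀ i : {i // ¬ P i}, ∃ z ∈ contactPoints K R d,
      (-symProd (z - d) (z - d), 0, z - d) = p i := fun i =>
    (hp ⟨i, rfl⟩).resolve_left i.2
  choose y hy hyp using fun i : {i // P i} => i.2
  choose z hz hzp using hQ
  rw [← Fintype.sum_subtype_add_sum_subtype P] at h0 hsum
  simp only [← hyp, ← hzp] at h0
  have h01 := congrArg Prod.fst h0
  have h02 := congrArg (fun q => q.2.1) h0
  have h03 := congrArg (fun q => q.2.2) h0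
  simp only [Prod.fst_add, Prod.snd_add, Prod.fst_sum, Prod.snd_sum, Prod.smul_fst, Prod.smul_snd,
    smul_neg, smul_zero, Finset.sum_const_zero, Finset.sum_neg_distrib, add_zero, zero_add,
    Prod.fst_zero, Prod.snd_zero] at h01 h02 h03
  obtain ⟨y', z', lam', mu', hD⟩ := exists_isAderDecomposition_of_fintype hr hR hy hz
    (fun i => ha i) (fun j => ha j) (eq_of_sub_eq_zero (by rwa [sub_eq_add_neg])) h02 h03
    (by rw [hsum]; exact one_pos)
  refine ⟨_, _, y', z', lam', mu', hD, ?_⟩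
  calc Fintype.card {i // P i} + Fintype.card {i // ¬ P i} = Fintype.card ι := by
        rw [← Fintype.card_sum, Fintype.card_congr (Equiv.sumCompl P)]
    _ ≤ Module.finrank ℝ _ + 1 := hind.card_le_finrank_succ
    _ ≤ n * (n + 5) / 2 + 1 := by
        rw [← finrank_sym2_prod]
        exact Nat.succ_le_succ (Submodule.finrank_le _)

/-- Separation of the origin from the contact vectors: the quadratic-affine forms given by `A`
and `v`, respectively `w`, have opposite signs at the inner and at the outer contact points. -/
theorem exists_separation_of_zero_notMem {r R : ℝ} (hr : 0 < r) (hR : 0 < R)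
    {c d : EuclideanSpace ℝ (Fin n)} (h : 0 ∉ convexHull ℝ (contactVectors K r R c d)) :
    ∃ A : Matrix (Fin n) (Fin n) ℝ, A.IsSymm ∧ ∃ v w : EuclideanSpace ℝ (Fin n),
      (∀ y ∈ contactPoints K r c, 0 < inner ℝ (y - c) (Matrix.toEuclideanLin A (y - c) + v)) ∧
      ∀ z ∈ contactPoints K R d, inner ℝ (z - d) (Matrix.toEuclideanLin A (z - d) + w) < 0 := by
  obtain ⟨f, hf⟩ := exists_pos_of_zero_notMem_convexHull (isCompact_contactVectors hr hR c d) h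
  obtain ⟨A, hA, hfA⟩ :=
    exists_isSymm_apply_symProd_self (f.toLinearMap ∘ₗ LinearMap.inl ℝ _ _)
  let f₁ := f ∘L ContinuousLinearMap.inr ℝ (Sym2 (Fin n) → ℝ) _ ∘L
    ContinuousLinearMap.inl ℝ (EuclideanSpace ℝ (Fin n)) (EuclideanSpace ℝ (Fin n))
  let f₂ := f ∘L ContinuousLinearMap.inr ℝ (Sym2 (Fin n) → ℝ) _ ∘L
    ContinuousLinearMap.inr ℝ (EuclideanSpace ℝ (Fin n)) (EuclideanSpace ℝ (Fin n))
  have hsplit : ∀ s x y, f (s, x, y) = f (s, 0) + f₁ x + f₂ y := fun s x y => by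
    simp [f₁, f₂, ← map_add]
  have hfA' : ∀ x, f (symProd x x, 0) = inner ℝ x (Matrix.toEuclideanLin A x) := hfA
  have hdual : ∀ (g : EuclideanSpace ℝ (Fin n) →L[ℝ] ℝ) (x : EuclideanSpace ℝ (Fin n)),
      inner ℝ x ((InnerProductSpace.toDual ℝ _).symm g) = g x := fun g x => by
    rw [real_inner_comm, InnerProductSpace.toDual_symm_apply]
  refine ⟨A, hA, (InnerProductSpace.toDual ℝ _).symm f₁, -(InnerProductSpace.toDual ℝ _).symm f₂,
    fun y hy => ?_, fun z hz => ?_⟩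
  · have := hf _ (Or.inl ⟨y, hy, rfl⟩)
    rw [hsplit, hfA', map_zero, add_zero] at this
    rwa [inner_add_right, hdual]
  · have := hf _ (Or.inr ⟨z, hz, rfl⟩)
    have hneg : f (-symProd (z - d) (z - d), 0) = -f (symProd (z - d) (z - d), 0) := by
      rw [← map_neg f, Prod.neg_mk, neg_zero]
    rw [hsplit, hneg, hfA', map_zero, add_zero] at this
    rw [inner_add_right, inner_neg_right, hdual]
    linarith

end BanachMazur

/-! ### The optimality criterion for the chain of balls -/

theorem mainTheorem3 (n : ℕ) (K : Set (EuclideanSpace ℝ (Fin n)))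
    (hK : BanachMazur.IsConvexBody K) (c d : EuclideanSpace ℝ (Fin n)) (r R : ℝ)
    (hr : 0 < r) (hrR : r ≤ R)
    (hinner : r • BanachMazur.unitBall n + {c} ⊆ K)
    (houter : K ⊆ R • BanachMazur.unitBall n + {d}) :
    (BanachMazur.dist K (BanachMazur.unitBall n) = R / r ↔
      ∀ A : Matrix (Fin n) (Fin n) ℝ, A.IsSymm → ∀ v w : EuclideanSpace ℝ (Fin n),
        ∃ y ∈ BanachMazur.contactPoints K r c, ∃ z ∈ BanachMazur.contactPoints K R d,
          inner ℝ (r⁻¹ • (y - c)) (Matrix.toEuclideanLin A (r⁻¹ • (y - c)) + v) ≤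
            inner ℝ (R⁻¹ • (z - d)) (Matrix.toEuclideanLin A (R⁻¹ • (z - d)) + w)) ∧
    (BanachMazur.dist K (BanachMazur.unitBall n) = R / r ↔
      ∃ (N M : ℕ) (y : Fin N → EuclideanSpace ℝ (Fin n)) (z : Fin M → EuclideanSpace ℝ (Fin n))
        (lam : Fin N → ℝ) (mu : Fin M → ℝ),
        BanachMazur.IsAderDecomposition K r R c d y z lam mu) ∧
    (∀ (N M : ℕ) (y : Fin N → EuclideanSpace ℝ (Fin n)) (z : Fin M → EuclideanSpace ℝ (Fin n))
      (lam : Fin N → ℝ) (mu : Fin M → ℝ),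
      BanachMazur.IsAderDecomposition K r R c d y z lam mu →
        r ^ 2 * ∑ i, lam i = R ^ 2 * ∑ j, mu j) ∧
    (BanachMazur.dist K (BanachMazur.unitBall n) = R / r →
      ∃ (N M : ℕ) (y : Fin N → EuclideanSpace ℝ (Fin n)) (z : Fin M → EuclideanSpace ℝ (Fin n))
        (lam : Fin N → ℝ) (mu : Fin M → ℝ),
        BanachMazur.IsAderDecomposition K r R c d y z lam mu ∧
          N + M ≤ n * (n + 5) / 2 + 1) := by
  have hR : 0 < R := hr.trans_le hrR
  rw [BanachMazur.smul_unitBall_add_singleton hr.le] at hinner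
  rw [BanachMazur.smul_unitBall_add_singleton hR.le] at houter
  -- the identity map bounds the distance from above, a decomposition bounds it from below
  have hmem := fun ρ (hρ : R / r ≤ ρ) (hρ1 : ρ ≠ 1) =>
    BanachMazur.mem_dist_set (K := K) (a := d) (b := c) hr hR (LinearEquiv.refl ℝ _)
      (fun x hx => mem_closedBall_iff_norm.1 (houter hx))
      (fun x hx => hinner (mem_closedBall_iff_norm.2 hx)) hρ hρ1
  have hdist : ∀ {N M : ℕ} {y : Fin N → EuclideanSpace ℝ (Fin n)}
      {z : Fin M → EuclideanSpace ℝ (Fin n)} {lam : Fin N → ℝ} {mu : Fin M → ℝ},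
      BanachMazur.IsAderDecomposition K r R c d y z lam mu →
        BanachMazur.dist K (BanachMazur.unitBall n) = R / r := by
    intro N M y z lam mu hD
    refine le_antisymm (BanachMazur.dist_le_div hr hR (LinearEquiv.refl ℝ _)
      (fun x hx => mem_closedBall_iff_norm.1 (houter hx))
      (fun x hx => hinner (mem_closedBall_iff_norm.2 hx))) (le_csInf ?_ ?_)
    · have h1 : 1 ≤ R / r := (one_le_div hr).2 hrR
      exact ⟨R / r + 1, hmem _ (by linarith) (by linarith)⟩
    · rintro ρ ⟨hρ, T, u, v, h1, h2⟩
      exact hD.div_le hK hr hR hinner hρ T u v h1 h2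
  have hsep := fun h0 => BanachMazur.exists_separation_of_zero_notMem (K := K) hr hR (c := c)
    (d := d) h0
  have hdec := BanachMazur.exists_isAderDecomposition_of_zero_mem (K := K) hr hR (c := c) (d := d)
  -- improving the ellipsoids shows that distance `R / r` forces a decomposition
  have hdec_of_dist : BanachMazur.dist K (BanachMazur.unitBall n) = R / r →
      0 ∈ convexHull ℝ (BanachMazur.contactVectors K r R c d) := by
    intro h
    by_contra h0
    obtain ⟨A, -, v, w, hy, hz⟩ := hsep h0
    exact (BanachMazur.dist_lt_of_separation hK hr hR hinner houter
      (Matrix.toEuclideanLin A).toContinuousLinearMap v w hy hz).ne h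
  refine ⟨⟨fun h A _ v w => ?_, fun h => ?_⟩, ⟨fun h => ?_, ?_⟩, ?_, fun h => hdec (hdec_of_dist h)⟩
  · obtain ⟨N, M, y, z, lam, mu, hD, -⟩ := hdec (hdec_of_dist h)
    exact hD.exists_le hr hR (Matrix.toEuclideanLin A) v w
  · suffices h0 : 0 ∈ convexHull ℝ (BanachMazur.contactVectors K r R c d) by
      obtain ⟨N, M, y, z, lam, mu, hD, -⟩ := hdec h0
      exact hdist hD
    by_contra h0
    obtain ⟨A, hA, v, w, hv, hw⟩ := hsep h0
    have hscale : ∀ (s : ℝ) (x q : EuclideanSpace ℝ (Fin n)),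
        inner ℝ (s⁻¹ • x) (Matrix.toEuclideanLin A (s⁻¹ • x) + s⁻¹ • q) =
          s⁻¹ ^ 2 * inner ℝ x (Matrix.toEuclideanLin A x + q) := fun s x q => by
      rw [map_smul, ← smul_add, real_inner_smul_left, inner_smul_right]
      ring
    obtain ⟨y, hy, z, hz, hle⟩ := h A hA (r⁻¹ • v) (R⁻¹ • w)
    rw [hscale, hscale] at hle
    have h1 := mul_pos (pow_pos (inv_pos.2 hr) 2) (hv y hy)
    have h2 := mul_neg_of_pos_of_neg (pow_pos (inv_pos.2 hR) 2) (hw z hz)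
    linarith
  · obtain ⟨N, M, y, z, lam, mu, hD, -⟩ := hdec (hdec_of_dist h)
    exact ⟨N, M, y, z, lam, mu, hD⟩
  · rintro ⟨N, M, y, z, lam, mu, hD⟩
    exact hdist hD
  · intro N M y z lam mu hD
    exact hD.sq_mul_sum_eq hr hR
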